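/- Call a positive integer $n$ almost abelian if, up to isomorphism, all but exactly one of the groups of order $n$ are abelian; that is, there is exactly one isomorphism class of nonabelian groups of order $n$. Let $n$ be an even positive integer. Then $n$ is almost abelian if and only if $n = 2p$ for some odd prime $p$. Equivalently, if $n = p_1^{n_1}\cdots p_k^{n_k}$ with primes $2 = p_1 < \dots < p_k$ and exponents $n_i \ge 1$, then $n$ is almost abelian if and only if $k = 2$ and $n_1 = n_2 = 1$. -/

import Mathlib

/-- A positive integer `n` is an almost `P`-number, for a class `P` of groups, if all but one group
of order `n` (up to isomorphism) are in `P`: there is a group `G` of order `n` outside `P`, and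
every group of order `n` that is not isomorphic to `G` belongs to `P`.
(Every finite group is isomorphic to one whose underlying type lives in `Type`.) -/
def IsAlmostNumber (P : ∀ (G : Type) [Group G], Prop) (n : ℕ) : Prop :=
  0 < n ∧ ∃ (G : Type) (_ : Group G), Nat.card G = n ∧ ¬ P G ∧
    ∀ (H : Type) [Group H], Nat.card H = n → ¬ Nonempty (H ≃* G) → P H

/-- The class of abelian groups. -/
def IsAbelianGroup (G : Type) [Group G] : Prop :=
  ∀ a b : G, a * b = b * a

/-- Almost abelian numbers: all but one group of order `n`, up to isomorphism, are abelian. -/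
def IsAlmostAbelianNumber (n : ℕ) : Prop :=
  IsAlmostNumber (fun G [Group G] => IsAbelianGroup G) n

theorem zpow_eq_zpow_of_intCast_eq {G : Type*} [Group G] {n : ℕ} {x : G} (hx : x ^ n = 1)
    {a b : ℤ} (h : (a : ZMod n) = b) : x ^ a = x ^ b := by
  rw [zpow_eq_zpow_iff_modEq]
  exact ((ZMod.intCast_eq_intCast_iff _ _ _).1 h).of_dvd
    (Int.natCast_dvd_natCast.2 (orderOf_dvd_of_pow_eq_one hx))

namespace DihedralGroup

/-- The homomorphism out of a dihedral group given by elements satisfying the defining relations. -/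
def lift {G : Type*} [Group G] {n : ℕ} (x s : G) (hx : x ^ n = 1) (hs : s * s = 1)
    (hsx : s * x * s = x⁻¹) : DihedralGroup n →* G :=
  have hinv : s⁻¹ = s := inv_eq_of_mul_eq_one_left hs
  have hconj (k : ℤ) : x ^ k * s = s * x ^ (-k) := by
    have h : (s * x * s⁻¹) ^ (-k) = x ^ k := by rw [hinv, hsx, inv_zpow, zpow_neg, inv_inv]
    rw [conj_zpow] at h
    rw [← h, inv_mul_cancel_right]
  MonoidHom.mk'
    (fun
      | r i => x ^ (i.cast : ℤ)
      | sr i => s * x ^ (i.cast : ℤ))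
    (by
      rintro (i | i) (j | j)
      · simp only [r_mul_r, ← zpow_add]
        exact zpow_eq_zpow_of_intCast_eq hx (by simp)
      · simp only [r_mul_sr, ← mul_assoc, hconj]
        rw [mul_assoc, ← zpow_add]
        exact congrArg _ (zpow_eq_zpow_of_intCast_eq hx (by simp; ring))
      · simp only [sr_mul_r, mul_assoc, ← zpow_add]
        exact congrArg _ (zpow_eq_zpow_of_intCast_eq hx (by simp))
      · simp only [sr_mul_sr]
        rw [mul_assoc, ← mul_assoc _ s, hconj, mul_assoc, ← mul_assoc, hs, one_mul, ← zpow_add]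
        exact zpow_eq_zpow_of_intCast_eq hx (by simp; ring))

theorem lift_r {G : Type*} [Group G] {n : ℕ} (x s : G) (hx : x ^ n = 1) (hs : s * s = 1)
    (hsx : s * x * s = x⁻¹) (i : ZMod n) : lift x s hx hs hsx (r i) = x ^ (i.cast : ℤ) := rfl

theorem lift_sr {G : Type*} [Group G] {n : ℕ} (x s : G) (hx : x ^ n = 1) (hs : s * s = 1)
    (hsx : s * x * s = x⁻¹) (i : ZMod n) :
    lift x s hx hs hsx (sr i) = s * x ^ (i.cast : ℤ) := rfl

/-- A reflection in the kernel would put `s` in the subgroup generated by `x`; a rotation in the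
kernel is trivial because `x` has order exactly `n`. -/
theorem lift_injective {G : Type*} [Group G] {n : ℕ} {x s : G} (hx : orderOf x = n)
    (hs : s * s = 1) (hsx : s * x * s = x⁻¹) (hmem : s ∉ Subgroup.zpowers x) :
    Function.Injective (lift x s (hx ▸ pow_orderOf_eq_one x) hs hsx) := by
  rw [injective_iff_map_eq_one]
  rintro (i | i) h
  · rw [lift_r, ← orderOf_dvd_iff_zpow_eq_one, hx, ← ZMod.intCast_zmod_eq_zero_iff_dvd] at h
    rw [ZMod.intCast_cast, ZMod.cast_id] at h
    rw [h, r_zero]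
  · rw [lift_sr] at h
    exact (hmem (eq_inv_of_mul_eq_one_left h ▸ inv_mem (Subgroup.zpow_mem_zpowers x _))).elim

end DihedralGroup

/-- A nonabelian group of order `2p`, with `p` an odd prime, is dihedral. -/
theorem nonempty_mulEquiv_dihedralGroup {G : Type*} [Group G] {p : ℕ} (hp : p.Prime) (hodd : Odd p)
    (hcard : Nat.card G = 2 * p) (hG : ¬ ∀ a b : G, a * b = b * a) :
    Nonempty (G ≃* DihedralGroup p) := by
  have := Fact.mk hp
  have hfin : Finite G := Nat.finite_of_card_ne_zero (by rw [hcard]; have := hp.pos; omega)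
  obtain ⟨x, hx⟩ := exists_prime_orderOf_dvd_card' (G := G) p ⟨2, by rw [hcard, mul_comm]⟩
  have hindex : (Subgroup.zpowers x).index = 2 := by
    have h := (Subgroup.zpowers x).card_mul_index
    rw [Nat.card_zpowers, hx, hcard, mul_comm 2] at h
    exact Nat.eq_of_mul_eq_mul_left hp.pos h
  -- Since `y ^ 2` lies in the index-2 subgroup and `p` is odd, `y ^ p = 1` would put `y` there too.
  -- If also `y ^ 2 ≠ 1`, then `y` has order `2p` and `G` is cyclic.
  have hout (y : G) (hy : y ∉ Subgroup.zpowers x) : y * y = 1 := by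
    by_contra hne
    rw [← sq] at hne
    have hyp : y ^ p ≠ 1 := by
      intro h
      obtain ⟨k, rfl⟩ := hodd
      have hsq := pow_mem (Subgroup.sq_mem_of_index_two hindex y) k
      rw [pow_succ, pow_mul] at h
      exact hy (eq_inv_of_mul_eq_one_right h ▸ inv_mem hsq)
    have hdvd : orderOf y ∣ 2 * p := hcard ▸ orderOf_dvd_natCard y
    have horder : orderOf y = 2 * p := by
      obtain ⟨a, b, ha, hb, hab⟩ := exists_dvd_and_dvd_of_dvd_mul hdvd
      rcases (Nat.dvd_prime Nat.prime_two).1 ha with rfl | rfl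
      · exact absurd (orderOf_dvd_iff_pow_eq_one.1 (by rw [hab, one_mul]; exact hb)) hyp
      · rcases (Nat.dvd_prime hp).1 hb with rfl | rfl
        · exact absurd (orderOf_dvd_iff_pow_eq_one.1 (by rw [hab, mul_one])) hne
        · exact hab
    have hcyc : IsCyclic G := isCyclic_of_orderOf_eq_card y (horder.trans hcard.symm)
    exact hG (@IsCyclic.commGroup G _ hcyc).mul_comm
  obtain ⟨s, hs⟩ : ∃ s, s ∉ Subgroup.zpowers x := by
    by_contra! h
    rw [(Subgroup.eq_top_iff' _).2 h, Subgroup.index_top] at hindex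
    omega
  have hsx : s * x ∉ Subgroup.zpowers x := by
    rw [Subgroup.mul_mem_iff_of_index_two hindex]
    simp [hs]
  -- The dihedral relation is just `(s * x) ^ 2 = 1`.
  have hrel : s * x * s = x⁻¹ := eq_inv_of_mul_eq_one_left (by rw [mul_assoc]; exact hout _ hsx)
  have hinj := DihedralGroup.lift_injective hx (hout s hs) hrel hs
  exact ⟨(MulEquiv.ofBijective _ ((Nat.bijective_iff_injective_and_card _).2
    ⟨hinj, by rw [hcard, DihedralGroup.nat_card]⟩)).symm⟩

theorem not_isAbelianGroup_dihedralGroup {n : ℕ} (hn : 2 < n) :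
    ¬ IsAbelianGroup (DihedralGroup n) := fun h =>
  DihedralGroup.not_commutative (by omega) (by omega) ⟨⟨h⟩⟩

theorem not_isAbelianGroup_quaternionGroup {n : ℕ} (hn : 2 ≤ n) :
    ¬ IsAbelianGroup (QuaternionGroup n) := by
  intro h
  have h1 := h (.a 1) (.xa 0)
  rw [QuaternionGroup.a_mul_xa, QuaternionGroup.xa_mul_a, QuaternionGroup.xa.injEq, zero_sub,
    zero_add, neg_eq_iff_add_eq_zero, one_add_one_eq_two] at h1
  have h2 : ((2 : ℕ) : ZMod (2 * n)) = 0 := by exact_mod_cast h1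
  rw [ZMod.natCast_eq_zero_iff] at h2
  have := Nat.le_of_dvd two_pos h2
  omega

/-- Each `xa j` has order 4, so the reflections, being involutions, would land in the cyclic part
and commute. They generate the dihedral group, which would then be abelian. -/
theorem not_nonempty_dihedralGroup_mulEquiv_quaternionGroup {n : ℕ} (hn : 2 ≤ n) :
    ¬ Nonempty (DihedralGroup (2 * n) ≃* QuaternionGroup n) := by
  rintro ⟨e⟩
  have : NeZero n := ⟨by omega⟩
  have himage (i : ZMod (2 * n)) : ∃ j, e (.sr i) = .a j := by
    have horder : orderOf (e (.sr i)) = 2 := by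
      rw [MulEquiv.orderOf_eq, DihedralGroup.orderOf_sr]
    rcases h : e (.sr i) with j | j
    · exact ⟨j, rfl⟩
    · rw [h, QuaternionGroup.orderOf_xa] at horder
      omega
  refine not_isAbelianGroup_dihedralGroup (n := 2 * n) (by omega) ?_
  have hcomm (i j : ZMod (2 * n)) : Commute (DihedralGroup.sr i) (.sr j) := by
    obtain ⟨k, hk⟩ := himage i
    obtain ⟨l, hl⟩ := himage j
    apply e.injective
    rw [map_mul, map_mul, hk, hl, QuaternionGroup.a_mul_a, QuaternionGroup.a_mul_a, add_comm]
  have hr (i : ZMod (2 * n)) : DihedralGroup.r i = .sr 0 * .sr i := by simp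
  rintro (i | i) (j | j)
  · rw [DihedralGroup.r_mul_r, DihedralGroup.r_mul_r, add_comm]
  · rw [hr]
    exact ((hcomm _ _).mul_left (hcomm _ _)).eq
  · rw [hr]
    exact ((hcomm _ _).mul_right (hcomm _ _)).eq
  · exact (hcomm _ _).eq

/-- The cyclic factor is central and nontrivial, while the dihedral group here has trivial center.
-/
theorem not_nonempty_dihedralGroup_mulEquiv_prod {a b : ℕ} (hodd : Odd (a * b)) (hb : 1 < b) :
    ¬ Nonempty (DihedralGroup (a * b) ≃* DihedralGroup a × Multiplicative (ZMod b)) := by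
  rintro ⟨e⟩
  have hab : a * b ≠ 1 := by
    intro h
    have := Nat.eq_one_of_mul_eq_one_left h
    omega
  have := Fact.mk hb
  let z : DihedralGroup a × Multiplicative (ZMod b) := (1, Multiplicative.ofAdd 1)
  have hz : e.symm z ∈ Subgroup.center (DihedralGroup (a * b)) := by
    rw [Subgroup.mem_center_iff]
    intro g
    apply e.injective
    rw [map_mul, map_mul, e.apply_symm_apply]
    exact Prod.ext (by simp [z]) (mul_comm _ _)
  rw [DihedralGroup.center_eq_bot_of_odd_ne_one hodd hab, Subgroup.mem_bot,
    EmbeddingLike.map_eq_one_iff] at hz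
  have h1 : (1 : ZMod b) = 0 := congrArg (fun w => Multiplicative.toAdd w.2) hz
  exact one_ne_zero h1

/-- Two nonisomorphic nonabelian groups of order `n` prevent `n` from being almost abelian. -/
theorem not_isAlmostAbelianNumber_of_nonempty_mulEquiv {n : ℕ} (G H : Type) [Group G] [Group H]
    (hG : Nat.card G = n) (hH : Nat.card H = n) (hGa : ¬ IsAbelianGroup G)
    (hHa : ¬ IsAbelianGroup H) (hGH : ¬ Nonempty (G ≃* H)) : ¬ IsAlmostAbelianNumber n := by
  rintro ⟨-, K, _, -, -, hK⟩
  obtain ⟨e⟩ := not_not.1 fun h => hGa (hK G hG h)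
  obtain ⟨f⟩ := not_not.1 fun h => hHa (hK H hH h)
  exact hGH ⟨e.trans f.symm⟩

theorem not_isAlmostAbelianNumber_of_forall {n : ℕ}
    (h : ∀ (G : Type) [Group G], Nat.card G = n → IsAbelianGroup G) :
    ¬ IsAlmostAbelianNumber n := by
  rintro ⟨-, K, _, hcard, hK, -⟩
  exact hK (h K hcard)

theorem isAlmostAbelianNumber_two_mul_prime {p : ℕ} (hp : p.Prime) (hodd : Odd p) :
    IsAlmostAbelianNumber (2 * p) := by
  have h2 : 2 < p := hp.two_le.lt_of_ne (by rintro rfl; exact absurd hodd (by decide))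
  refine ⟨by omega, DihedralGroup p, inferInstance, DihedralGroup.nat_card,
    not_isAbelianGroup_dihedralGroup h2, fun H _ hcard hiso => ?_⟩
  by_contra hH
  exact hiso (nonempty_mulEquiv_dihedralGroup hp hodd hcard hH)

theorem not_isAlmostAbelianNumber_two : ¬ IsAlmostAbelianNumber 2 := by
  refine not_isAlmostAbelianNumber_of_forall fun G _ hG => ?_
  have := isCyclic_of_prime_card hG
  exact (IsCyclic.commGroup (α := G)).mul_comm

theorem not_isAlmostAbelianNumber_four_mul {t : ℕ} (ht : 0 < t) :
    ¬ IsAlmostAbelianNumber (4 * t) := by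
  -- The case `t = 1` is separate because groups of order `2 ^ 2` are all abelian.
  obtain rfl | ht : t = 1 ∨ 2 ≤ t := by omega
  · refine not_isAlmostAbelianNumber_of_forall fun G _ hG => ?_
    have := Fact.mk Nat.prime_two
    exact (IsPGroup.commGroupOfCardEqPrimeSq (p := 2) hG).mul_comm
  · have : NeZero t := ⟨by omega⟩
    exact not_isAlmostAbelianNumber_of_nonempty_mulEquiv (DihedralGroup (2 * t)) (QuaternionGroup t)
      (by rw [DihedralGroup.nat_card]; ring)
      (by rw [Nat.card_eq_fintype_card, QuaternionGroup.card])
      (not_isAbelianGroup_dihedralGroup (by omega)) (not_isAbelianGroup_quaternionGroup ht)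
      (not_nonempty_dihedralGroup_mulEquiv_quaternionGroup ht)

theorem not_isAlmostAbelianNumber_two_mul_mul {a b : ℕ} (hodd : Odd (a * b)) (ha : 1 < a)
    (hb : 1 < b) : ¬ IsAlmostAbelianNumber (2 * (a * b)) := by
  obtain ⟨haodd, hbodd⟩ := Nat.odd_mul.1 hodd
  have ha2 : 2 < a := by obtain ⟨k, rfl⟩ := haodd; omega
  refine not_isAlmostAbelianNumber_of_nonempty_mulEquiv (DihedralGroup (a * b))
    (DihedralGroup a × Multiplicative (ZMod b)) DihedralGroup.nat_card ?_
    (not_isAbelianGroup_dihedralGroup (by nlinarith)) ?_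
    (not_nonempty_dihedralGroup_mulEquiv_prod hodd hb)
  · rw [Nat.card_prod, DihedralGroup.nat_card, Nat.card_congr Multiplicative.toAdd, Nat.card_zmod,
      mul_assoc]
  · intro h
    exact not_isAbelianGroup_dihedralGroup ha2
      fun x y => congrArg Prod.fst (h (x, 1) (y, 1))

theorem isAlmostAbelianNumber_iff_of_even {n : ℕ} (hn : 0 < n) (heven : Even n) :
    IsAlmostAbelianNumber n ↔ ∃ p : ℕ, p.Prime ∧ Odd p ∧ n = 2 * p := by
  refine ⟨fun h => ?_, ?_⟩
  · obtain ⟨m, rfl⟩ := heven.two_dvd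
    refine ⟨m, ?_, ?_, rfl⟩ <;> by_contra hm
    · by_cases hodd : Odd m
      · obtain rfl | hm1 : m = 1 ∨ 2 ≤ m := by omega
        · exact not_isAlmostAbelianNumber_two h
        · obtain ⟨a, b, ha, hb, rfl⟩ := (Nat.not_prime_iff_exists_mul_eq hm1).1 hm
          have ha0 : a ≠ 0 := by rintro rfl; simp at hn
          have hb0 : b ≠ 0 := by rintro rfl; simp at hn
          exact not_isAlmostAbelianNumber_two_mul_mul hodd (by nlinarith) (by nlinarith) h
      · obtain ⟨t, rfl⟩ := (Nat.not_odd_iff_even.1 hodd).two_dvd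
        rw [← mul_assoc] at h
        exact not_isAlmostAbelianNumber_four_mul (by omega) h
    · obtain ⟨t, rfl⟩ := (Nat.not_odd_iff_even.1 hm).two_dvd
      rw [← mul_assoc] at h
      exact not_isAlmostAbelianNumber_four_mul (by omega) h
  · rintro ⟨p, hp, hodd, rfl⟩
    exact isAlmostAbelianNumber_two_mul_prime hp hodd

theorem prod_prime_pow_eq_two_mul_prime_iff {k : ℕ} (hk : 0 < k) {p e : Fin k → ℕ}
    (hp : ∀ i, (p i).Prime) (hmono : StrictMono p) (h0 : p ⟨0, hk⟩ = 2) (he : ∀ i, 1 ≤ e i) :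
    (∃ q : ℕ, q.Prime ∧ Odd q ∧ ∏ i, p i ^ e i = 2 * q) ↔ k = 2 ∧ ∀ i, e i = 1 := by
  constructor
  · rintro ⟨q, hq, hodd, hprod⟩
    have hfac (i : Fin k) : (∏ j, p j ^ e j).factorization (p i) = e i := by
      rw [Nat.factorization_prod_apply (fun j _ => pow_ne_zero _ (hp j).ne_zero),
        Finset.sum_eq_single i]
      · simp [(hp i).factorization_self]
      · intro j _ hj
        rw [Nat.factorization_pow, Finsupp.smul_apply, (hp j).factorization,
          Finsupp.single_eq_of_ne' (hmono.injective.ne hj), smul_zero]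
      · simp
    have h2q : 2 ≠ q := by rintro rfl; exact absurd hodd (by decide)
    have hsq : Squarefree (2 * q) := by
      rw [Nat.squarefree_mul ((Nat.coprime_primes Nat.prime_two hq).2 h2q)]
      exact ⟨Nat.prime_two.prime.squarefree, hq.prime.squarefree⟩
    have he1 (i : Fin k) : e i = 1 := by
      refine le_antisymm ?_ (he i)
      rw [← hfac i, hprod]
      exact hsq.natFactorization_le_one _
    refine ⟨?_, he1⟩
    -- With all exponents 1, comparing the sets of prime factors of the two products gives `k = 2`.
    have hprod' : ∏ r ∈ Finset.univ.map ⟨p, hmono.injective⟩, r = ∏ r ∈ {2, q}, r := by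
      simpa [Finset.prod_map, Finset.prod_pair h2q, he1] using hprod
    have hset := congrArg Nat.primeFactors hprod'
    rw [Nat.primeFactors_prod (by simpa using hp),
      Nat.primeFactors_prod (by simp [Nat.prime_two, hq])] at hset
    simpa [Finset.card_pair h2q] using congrArg Finset.card hset
  · rintro ⟨rfl, he1⟩
    have h01 : p 0 < p 1 := hmono (by decide)
    have h0' : p 0 = 2 := h0
    refine ⟨p 1, hp 1, (hp 1).odd_of_ne_two (by omega), ?_⟩
    rw [Fin.prod_univ_two, he1, he1, pow_one, pow_one, h0']

theorem mainTheorem3 :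
    (∀ n : ℕ, 0 < n → Even n →
      (IsAlmostAbelianNumber n ↔ ∃ p : ℕ, p.Prime ∧ Odd p ∧ n = 2 * p)) ∧
    (∀ (k : ℕ) (hk : 0 < k) (p e : Fin k → ℕ),
      (∀ i, (p i).Prime) → StrictMono p → p ⟨0, hk⟩ = 2 → (∀ i, 1 ≤ e i) →
      (IsAlmostAbelianNumber (∏ i, p i ^ e i) ↔ k = 2 ∧ ∀ i, e i = 1)) := by
  refine ⟨fun n hn heven => isAlmostAbelianNumber_iff_of_even hn heven, ?_⟩
  intro k hk p e hp hmono h0 he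
  have hpos : 0 < ∏ i, p i ^ e i := Finset.prod_pos fun i _ => pow_pos (hp i).pos _
  have heven : Even (∏ i, p i ^ e i) := by
    refine even_iff_two_dvd.2 (dvd_trans ?_ (Finset.dvd_prod_of_mem _ (Finset.mem_univ ⟨0, hk⟩)))
    rw [h0]
    exact dvd_pow_self 2 (Nat.one_le_iff_ne_zero.1 (he _))
  rw [isAlmostAbelianNumber_iff_of_even hpos heven,
    prod_prime_pow_eq_two_mul_prime_iff hk hp hmono h0 he]
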